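/- A signed graph $\Sigma=(\Gamma,\sigma)$ consists of a finite simple graph $\Gamma$ and a map $\sigma:E(\Gamma)\to\{+1,-1\}$; $\Delta(\Sigma)$ is the maximum degree of $\Gamma$. Let $M_n=\{0,\pm1,\ldots,\pm k\}$ if $n=2k+1$ and $M_n=\{\pm1,\ldots,\pm k\}$ if $n=2k$. An $n$-edge colouring of $\Sigma$ is a map $\gamma$ assigning to each incidence $(v,e)$ (a vertex $v$ together with an edge $e$ having $v$ as an endpoint) a colour $\gamma(v,e)\in M_n$ such that $\gamma(v,e)=-\sigma(e)\,\gamma(w,e)$ for every edge $e$ with endpoints $v\neq w$. It is proper if $\gamma(v,e)\neq\gamma(v,f)$ for any two distinct edges $e,f$ at the same vertex $v$, and zero-free if it never takes the value $0$. Theorem. Let $\Sigma$ be a signed graph such that $\Delta(\Sigma)$ is even and no two vertices of degree $\Delta(\Sigma)$ are adjacent. Then $\Sigma$ has a proper zero-free $\Delta(\Sigma)$-edge colouring. -/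

import Mathlib

/-- A signed simple graph `(Γ, σ)` on the vertex set `V`; the signs are the units `1, -1` of `ℤ`. -/
structure SignedGraph (V : Type*) where
  /-- The underlying simple graph. -/
  graph : SimpleGraph V
  /-- The signature. -/
  sign : graph.edgeSet → ℤˣ

namespace SignedGraph

/-- A vertex-edge incidence of a signed graph. -/
@[ext]
structure Incidence {V : Type*} (S : SignedGraph V) where
  /-- The vertex of the incidence. -/
  vertex : V
  /-- The edge of the incidence. -/
  edge : S.graph.edgeSet
  /-- The vertex is an endpoint of the edge. -/
  mem : vertex ∈ (edge : Sym2 V)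

/-- The signed colour set `M_n`: the integers `0, ±1, …, ±k` if `n = 2k + 1`, and
`±1, …, ±k` if `n = 2k`. -/
def signedColors (n : ℕ) : Set ℤ :=
  {c : ℤ | |c| ≤ ((n / 2 : ℕ) : ℤ) ∧ (Even n → c ≠ 0)}

/-- `γ` is an `n`-edge colouring: each incidence gets a colour from `M_n`, and
`γ(v, e) = -σ(e) γ(w, e)` for every edge `e` with endpoints `v` and `w`. -/
def IsEdgeColoring {V : Type*} (S : SignedGraph V) (n : ℕ) (γ : S.Incidence → ℤ) : Prop :=
  (∀ i, γ i ∈ signedColors n) ∧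
    ∀ i j : S.Incidence, i.edge = j.edge → i.vertex ≠ j.vertex →
      γ i = -(S.sign i.edge : ℤ) * γ j

/-- A colouring is proper if different incidences at the same vertex get different colours. -/
def IsProper {V : Type*} (S : SignedGraph V) (γ : S.Incidence → ℤ) : Prop :=
  ∀ i j : S.Incidence, i.vertex = j.vertex → i.edge ≠ j.edge → γ i ≠ γ j

/-- A colouring is zero-free if it never uses the colour `0`. -/
def IsZeroFree {V : Type*} (S : SignedGraph V) (γ : S.Incidence → ℤ) : Prop :=
  ∀ i, γ i ≠ 0

/-- The set of vertices of maximum degree. -/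
def maxDegreeVertices {V : Type*} [Fintype V] (S : SignedGraph V) [DecidableRel S.graph.Adj] :
    Set V :=
  {v | S.graph.degree v = S.graph.maxDegree}

end SignedGraph

section

open Finset

namespace SignedGraph

/-! ### Matchings and minimal Hall violators. -/

section Matching

variable {α β : Type*}

/-! Induct on the number of edges, with the `2 * k` nonzero colours fixed. Choose a non-isolated
vertex `u` all of whose neighbours have degree below `2 * k`, delete its edges, and colour the rest.
Each neighbour `v` then misses at least two colours. Multiplied by `-s u v`, these become colours
usable on the edge `uv` at `u`, so it suffices to choose distinct representatives from these sets,
after recolouring if necessary.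

Keep exactly two missing colours per neighbour, as a bipartite graph `E`. Over all colourings and
choices, maximise first the matching number, then the number of colours missed by some maximum
matching. If `E` does not match all neighbours, a minimal Hall violator `A` has one vertex more than
its neighbourhood, so some colour `c` there is paired with at least three members of `A`. Let `c'`
be missed by a maximum matching `M`; it lies outside that neighbourhood. Exchanging `c` with `c'`
and `-c` with `-c'` along the Kempe component starting at `(v, c)` moves that pair and at most one
other pair `q` of `E`. Maximality forces `q` to exist, to lie in `M` away from `A`, and to have
colour `-c` or `-c'` (`exists_injOn_of_kempe_closed`). Three vertices `v` compete for two such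
pairs, so two of them share a component with the same `q`. This is impossible: a component is an
orbit of two involutions and has at most two ends (`eq_of_sameCycle_of_fixed`). -/

/-- Hall's marriage theorem relative to a finite set. -/
theorem exists_injOn_of_hall [DecidableEq β] [Nonempty β] (A : Finset α) (t : α → Finset β)
    (h : ∀ B ⊆ A, #B ≤ #(B.biUnion t)) :
    ∃ f : α → β, Set.InjOn f A ∧ ∀ x ∈ A, f x ∈ t x := by
  classical
  obtain ⟨f, hf, hft⟩ := (Finset.all_card_le_biUnion_card_iff_exists_injective
    (fun x : A => t x)).1 (by
      intro s
      have := h (s.map (Function.Embedding.subtype _)) (by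
        intro x hx
        obtain ⟨y, -, rfl⟩ := Finset.mem_map.1 hx
        exact y.2)
      rw [Finset.card_map] at this
      refine this.trans (Finset.card_le_card ?_)
      intro y hy
      simp only [Finset.mem_biUnion, Finset.mem_map] at hy ⊢
      obtain ⟨x, ⟨z, hz, rfl⟩, hy⟩ := hy
      exact ⟨z, hz, hy⟩)
  refine ⟨fun x => if hx : x ∈ A then f ⟨x, hx⟩ else Classical.arbitrary β, ?_, ?_⟩
  · intro x hx y hy hxy
    have hx' : x ∈ A := hx
    have hy' : y ∈ A := hy
    simp only [hx', hy', dif_pos] at hxy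
    simpa using hf hxy
  · intro x hx
    simp only [hx, dif_pos]
    exact hft ⟨x, hx⟩

/-- A set of pairs is a matching if no two of its pairs share a coordinate. -/
def IsPairMatching (M : Finset (α × β)) : Prop :=
  Set.InjOn Prod.fst (M : Set (α × β)) ∧ Set.InjOn Prod.snd (M : Set (α × β))

theorem IsPairMatching.subset {M M' : Finset (α × β)} (hM : IsPairMatching M) (h : M' ⊆ M) :
    IsPairMatching M' :=
  ⟨hM.1.mono (by exact_mod_cast h), hM.2.mono (by exact_mod_cast h)⟩

open Classical in
/-- The largest size of a matching contained in `E`. -/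
noncomputable def matchNum (E : Finset (α × β)) : ℕ :=
  {M ∈ E.powerset | IsPairMatching M}.sup Finset.card

theorem card_le_matchNum {E M : Finset (α × β)} (h : M ⊆ E) (hM : IsPairMatching M) :
    #M ≤ matchNum E := by
  classical
  exact Finset.le_sup (f := Finset.card) (by simp [h, hM])

theorem exists_card_eq_matchNum (E : Finset (α × β)) :
    ∃ M ⊆ E, IsPairMatching M ∧ #M = matchNum E := by
  classical
  obtain ⟨M, hM, h⟩ := Finset.exists_mem_eq_sup {M ∈ E.powerset | IsPairMatching M}
    ⟨∅, Finset.mem_filter.2 ⟨by simp, by simp [IsPairMatching]⟩⟩ Finset.card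
  simp only [Finset.mem_filter, Finset.mem_powerset] at hM
  refine ⟨M, hM.1, hM.2, ?_⟩
  rw [matchNum, ← h]

open Classical in
/-- The elements of `K` that are missed by some largest matching of `E`. -/
noncomputable def missed (K : Finset β) (E : Finset (α × β)) : Finset β :=
  {c ∈ K | ∃ M ⊆ E, IsPairMatching M ∧ #M = matchNum E ∧ ∀ q ∈ M, q.2 ≠ c}

theorem mem_missed {K : Finset β} {E : Finset (α × β)} {c : β} : c ∈ missed K E ↔
    c ∈ K ∧ ∃ M ⊆ E, IsPairMatching M ∧ #M = matchNum E ∧ ∀ q ∈ M, q.2 ≠ c := by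
  classical
  simp [missed]

/-- A matching as large as the first side is the graph of an injection. -/
theorem exists_injOn_of_le_matchNum [DecidableEq α] [Nonempty β] {N : Finset α} {E : Finset (α × β)}
    (hE : ∀ q ∈ E, q.1 ∈ N) (h : #N ≤ matchNum E) :
    ∃ f : α → β, Set.InjOn f N ∧ ∀ v ∈ N, (v, f v) ∈ E := by
  classical
  obtain ⟨M, hME, hM, hc⟩ := exists_card_eq_matchNum E
  have himg : M.image Prod.fst = N := by
    apply Finset.eq_of_subset_of_card_le
    · intro v hv
      obtain ⟨q, hq, rfl⟩ := Finset.mem_image.1 hv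
      exact hE q (hME hq)
    · rw [Finset.card_image_of_injOn hM.1, hc]
      exact h
  have hex : ∀ v ∈ N, ∃ c, (v, c) ∈ M := by
    intro v hv
    rw [← himg] at hv
    obtain ⟨q, hq, rfl⟩ := Finset.mem_image.1 hv
    exact ⟨q.2, hq⟩
  choose! f hf using hex
  exact ⟨f, fun a ha b hb hab => (Prod.ext_iff.1 (hM.2 (hf a ha) (hf b hb) hab)).1,
    fun v hv => hME (hf v hv)⟩

variable [DecidableEq α] [DecidableEq β]

/-- The second coordinates of the pairs in `E` that start with `v`. -/
def row (E : Finset (α × β)) (v : α) : Finset β := {q ∈ E | q.1 = v}.image Prod.snd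

theorem mem_row {E : Finset (α × β)} {v : α} {c : β} : c ∈ row E v ↔ (v, c) ∈ E := by
  simp [row]

/-- A matching can be enlarged by another one that uses different coordinates. -/
theorem IsPairMatching.union {M M' : Finset (α × β)}
    (hM : IsPairMatching M) (hM' : IsPairMatching M')
    (h1 : ∀ q ∈ M, ∀ q' ∈ M', q.1 ≠ q'.1) (h2 : ∀ q ∈ M, ∀ q' ∈ M', q.2 ≠ q'.2) :
    IsPairMatching (M ∪ M') ∧ #(M ∪ M') = #M + #M' := by
  refine ⟨⟨?_, ?_⟩, ?_⟩
  · intro x hx y hy hxy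
    simp only [Finset.coe_union, Set.mem_union, Finset.mem_coe] at hx hy
    rcases hx with hx | hx <;> rcases hy with hy | hy
    · exact hM.1 hx hy hxy
    · exact (h1 _ hx _ hy hxy).elim
    · exact (h1 _ hy _ hx hxy.symm).elim
    · exact hM'.1 hx hy hxy
  · intro x hx y hy hxy
    simp only [Finset.coe_union, Set.mem_union, Finset.mem_coe] at hx hy
    rcases hx with hx | hx <;> rcases hy with hy | hy
    · exact hM.2 hx hy hxy
    · exact (h2 _ hx _ hy hxy).elim
    · exact (h2 _ hy _ hx hxy.symm).elim
    · exact hM'.2 hx hy hxy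
  · refine Finset.card_union_of_disjoint (Finset.disjoint_left.2 fun q hq hq' => ?_)
    exact h1 q hq q hq' rfl

/-- The graph of an injection is a matching. -/
theorem isPairMatching_graph {A : Finset α} {f : α → β} (hf : Set.InjOn f A) :
    IsPairMatching (A.image fun a => (a, f a)) ∧ #(A.image fun a => (a, f a)) = #A := by
  refine ⟨⟨?_, ?_⟩, Finset.card_image_of_injective _ fun a b h => (Prod.ext_iff.1 h).1⟩
  · rintro x hx y hy hxy
    simp only [Finset.coe_image, Set.mem_image, Finset.mem_coe] at hx hy
    obtain ⟨a, ha, rfl⟩ := hx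
    obtain ⟨b, hb, rfl⟩ := hy
    simp_all
  · rintro x hx y hy hxy
    simp only [Finset.coe_image, Set.mem_image, Finset.mem_coe] at hx hy
    obtain ⟨a, ha, rfl⟩ := hx
    obtain ⟨b, hb, rfl⟩ := hy
    have := hf ha hb hxy
    simp_all

/-- The inverse graph of an injection is a matching. -/
theorem isPairMatching_graph_symm {P : Finset β} {f : β → α} (hf : Set.InjOn f P) :
    IsPairMatching (P.image fun p => (f p, p)) ∧ #(P.image fun p => (f p, p)) = #P := by
  refine ⟨⟨?_, ?_⟩, Finset.card_image_of_injective _ fun a b h => (Prod.ext_iff.1 h).2⟩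
  · rintro x hx y hy hxy
    simp only [Finset.coe_image, Set.mem_image, Finset.mem_coe] at hx hy
    obtain ⟨a, ha, rfl⟩ := hx
    obtain ⟨b, hb, rfl⟩ := hy
    have := hf ha hb hxy
    simp_all
  · rintro x hx y hy hxy
    simp only [Finset.coe_image, Set.mem_image, Finset.mem_coe] at hx hy
    obtain ⟨a, ha, rfl⟩ := hx
    obtain ⟨b, hb, rfl⟩ := hy
    simp_all

/-- A minimal violator of Hall's condition. -/
structure IsMinViolator (E : Finset (α × β)) (A : Finset α) : Prop where
  hall : ∀ B ⊆ A, B ≠ A → #B ≤ #(B.biUnion (row E))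
  card : #(A.biUnion (row E)) + 1 = #A

theorem exists_isMinViolator [Nonempty β] {N : Finset α} {E : Finset (α × β)}
    (h : matchNum E < #N) : ∃ A ⊆ N, IsMinViolator E A := by
  classical
  have hne : {A ∈ N.powerset | #(A.biUnion (row E)) < #A}.Nonempty := by
    by_contra hne
    rw [Finset.not_nonempty_iff_eq_empty] at hne
    obtain ⟨f, hf, hfE⟩ := exists_injOn_of_hall N (row E) (by
      intro B hB
      by_contra hlt
      have : B ∈ ({A ∈ N.powerset | #(A.biUnion (row E)) < #A} : Finset _) := by
        simp only [Finset.mem_filter, Finset.mem_powerset]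
        exact ⟨hB, by omega⟩
      simp [hne] at this)
    obtain ⟨hg, hgc⟩ := isPairMatching_graph hf
    have := card_le_matchNum (E := E) (by
      intro q hq
      obtain ⟨a, ha, rfl⟩ := Finset.mem_image.1 hq
      exact mem_row.1 (hfE a ha)) hg
    omega
  obtain ⟨A, hA, hmin⟩ := Finset.exists_min_image _ Finset.card hne
  simp only [Finset.mem_filter, Finset.mem_powerset] at hA hmin
  have hall : ∀ B ⊆ A, B ≠ A → #B ≤ #(B.biUnion (row E)) := by
    intro B hB hne
    by_contra hlt
    have h1 := hmin B ⟨hB.trans hA.1, by omega⟩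
    exact hne (Finset.eq_of_subset_of_card_le hB h1)
  -- Deleting one element of `A` restores Hall's condition, so the deficiency is exactly one.
  refine ⟨A, hA.1, hall, ?_⟩
  have hpos : A.Nonempty := Finset.card_pos.1 (by omega)
  obtain ⟨g, hg⟩ := hpos
  have h1 := hall (A.erase g) (Finset.erase_subset _ _) (by
    intro h; rw [← h] at hg; exact Finset.notMem_erase g A hg)
  have h2 : #((A.erase g).biUnion (row E)) ≤ #(A.biUnion (row E)) :=
    Finset.card_le_card (Finset.biUnion_subset_biUnion_of_subset_left _ (Finset.erase_subset _ _))
  rw [Finset.card_erase_of_mem hg] at h1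
  omega

/-- The elements of `A` that are paired in `E` with a member of `P`. -/
def touching (E : Finset (α × β)) (A : Finset α) (P : Finset β) : Finset α :=
  {v ∈ A | ∃ c ∈ P, (v, c) ∈ E}

/-- The members of `A` that do not touch `P` form a proper subset with neighbours outside `P`.
Hall's condition for them, with the deficiency one of `A`, gives the strict inequality. -/
theorem IsMinViolator.card_lt_touching {E : Finset (α × β)} {A : Finset α}
    (h : IsMinViolator E A) {P : Finset β} (hP : P ⊆ A.biUnion (row E)) (hne : P.Nonempty) :
    #P < #(touching E A P) := by
  have hsub : touching E A P ⊆ A := Finset.filter_subset _ _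
  have h1 := h.hall (A \ touching E A P) Finset.sdiff_subset (by
    intro heq
    obtain ⟨c, hc⟩ := hne
    obtain ⟨v, hv, hcv⟩ := Finset.mem_biUnion.1 (hP hc)
    have hvt : v ∈ touching E A P := by
      simp only [touching, Finset.mem_filter]
      exact ⟨hv, c, hc, mem_row.1 hcv⟩
    rw [← heq] at hv
    exact (Finset.mem_sdiff.1 hv).2 hvt)
  have h2 : (A \ touching E A P).biUnion (row E) ⊆ A.biUnion (row E) \ P := by
    intro c hc
    obtain ⟨v, hv, hcv⟩ := Finset.mem_biUnion.1 hc
    rw [Finset.mem_sdiff] at hv ⊢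
    refine ⟨Finset.mem_biUnion.2 ⟨v, hv.1, hcv⟩, fun hcP => hv.2 ?_⟩
    simp only [touching, Finset.mem_filter]
    exact ⟨hv.1, c, hcP, mem_row.1 hcv⟩
  have h3 := Finset.card_le_card h2
  rw [Finset.card_sdiff_of_subset hP] at h3
  rw [Finset.card_sdiff_of_subset hsub] at h1
  have h4 := h.card
  have h5 := Finset.card_le_card hsub
  have h6 := Finset.card_le_card hP
  omega

/-- The elements of `A` paired with `c`. -/
def column (E : Finset (α × β)) (A : Finset α) (c : β) : Finset α := {v ∈ A | (v, c) ∈ E}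

theorem IsMinViolator.two_le_card_column {E : Finset (α × β)} {A : Finset α}
    (h : IsMinViolator E A) {c : β} (hc : c ∈ A.biUnion (row E)) : 2 ≤ #(column E A c) := by
  have := h.card_lt_touching (Finset.singleton_subset_iff.2 hc) (Finset.singleton_nonempty c)
  simpa [touching, column, Nat.lt_iff_add_one_le] using this

/-- Double counting of the pairs of `E` in `A × P`. -/
theorem sum_card_column (E : Finset (α × β)) (A : Finset α) (P : Finset β) :
    ∑ c ∈ P, #(column E A c) = ∑ v ∈ A, #(row E v ∩ P) := by
  have h := Finset.sum_card_bipartiteAbove_eq_sum_card_bipartiteBelow (s := A) (t := P)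
    (fun v c => (v, c) ∈ E)
  simp only [Finset.bipartiteAbove, Finset.bipartiteBelow] at h
  rw [show ∑ c ∈ P, #(column E A c) = ∑ c ∈ P, #{a ∈ A | (a, c) ∈ E} from rfl, ← h]
  refine Finset.sum_congr rfl fun v _ => ?_
  congr 1
  ext c
  simp [mem_row, and_comm]

/-- The columns sum to twice `#A`, which is two more than twice the number of columns. -/
theorem IsMinViolator.exists_three_le_card_column {E : Finset (α × β)} {A : Finset α}
    (h : IsMinViolator E A) (hrow : ∀ v ∈ A, #(row E v) = 2) :
    ∃ c ∈ A.biUnion (row E), 3 ≤ #(column E A c) := by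
  by_contra! hlt
  have h1 := sum_card_column E A (A.biUnion (row E))
  have h2 : ∑ v ∈ A, #(row E v ∩ A.biUnion (row E)) = ∑ v ∈ A, 2 := by
    refine Finset.sum_congr rfl fun v hv => ?_
    rw [Finset.inter_eq_left.2 (Finset.subset_biUnion_of_mem (row E) hv), hrow v hv]
  have h3 : ∑ c ∈ A.biUnion (row E), #(column E A c) ≤ ∑ c ∈ A.biUnion (row E), 2 :=
    Finset.sum_le_sum fun c hc => by have := hlt c hc; omega
  have h4 := h.card
  simp only [Finset.sum_const, smul_eq_mul] at h2 h3
  omega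

end Matching

/-! ### Exchanges at a minimal violator. -/

section Matching

variable {α β : Type*} [DecidableEq α] [DecidableEq β]

/-- The pairs of `M` whose second coordinate is not paired with a member of `A`. -/
def outside (E : Finset (α × β)) (A : Finset α) (M : Finset (α × β)) : Finset (α × β) :=
  {q ∈ M | q.2 ∉ A.biUnion (row E)}

variable {E M : Finset (α × β)} {A : Finset α}

theorem outside_subset : outside E A M ⊆ M := Finset.filter_subset _ _

theorem fst_notMem_of_mem_outside (hM : M ⊆ E) {q : α × β} (hq : q ∈ outside E A M) :
    q.1 ∉ A := by
  intro hqA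
  simp only [outside, Finset.mem_filter] at hq
  exact hq.2 (Finset.mem_biUnion.2 ⟨q.1, hqA, mem_row.2 (hM hq.1)⟩)

theorem card_le_card_outside (hM : IsPairMatching M) {P : Finset β}
    (hP : ∀ q ∈ M, q.2 ∈ A.biUnion (row E) → q.2 ∈ P) : #M ≤ #(outside E A M) + #P := by
  rw [← Finset.card_filter_add_card_filter_not (s := M) (fun q => q.2 ∉ A.biUnion (row E))]
  refine Nat.add_le_add_left ?_ _
  refine Finset.card_le_card_of_injOn Prod.snd ?_ (hM.2.mono ?_)
  · intro q hq
    simp only [not_not, Finset.coe_filter, Set.mem_ofPred_eq] at hq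
    exact hP q hq.1 hq.2
  · intro q hq
    simp only [not_not, Finset.coe_filter, Set.mem_ofPred_eq] at hq
    exact hq.1

/-- Replacing the part of a matching that uses the neighbours of `A`. -/
theorem isPairMatching_outside_union (hME : M ⊆ E) (hM : IsPairMatching M)
    {M' : Finset (α × β)} (hM' : IsPairMatching M') (h1 : ∀ q ∈ M', q.1 ∈ A)
    (h2 : ∀ q ∈ M', q.2 ∈ A.biUnion (row E) ∨ ∀ r ∈ M, r.2 ≠ q.2) :
    IsPairMatching (outside E A M ∪ M') ∧
      #(outside E A M ∪ M') = #(outside E A M) + #M' := by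
  refine (hM.subset outside_subset).union hM' ?_ ?_
  · intro q hq r hr h
    exact fst_notMem_of_mem_outside hME hq (h ▸ h1 r hr)
  · intro q hq r hr h
    rcases h2 r hr with h3 | h3
    · simp only [outside, Finset.mem_filter] at hq
      exact hq.2 (h ▸ h3)
    · exact h3 q (outside_subset hq) h

theorem IsMinViolator.nonempty (hA : IsMinViolator E A) : A.Nonempty :=
  Finset.card_pos.1 (by have := hA.card; omega)

/-- All of `A` but one element can be matched onto its whole neighbourhood. If a maximum matching
missed a colour there, substituting this matching for its part on the neighbourhood would enlarge
it. -/
theorem IsMinViolator.notMem_of_mem_missed [Nonempty β] (hA : IsMinViolator E A)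
    {K : Finset β} {c : β} (hc : c ∈ missed K E) : c ∉ A.biUnion (row E) := by
  intro hcA
  obtain ⟨-, M, hME, hM, hcard, hmiss⟩ := mem_missed.1 hc
  obtain ⟨g, hg⟩ := hA.nonempty
  obtain ⟨f, hf, hfE⟩ := exists_injOn_of_hall (A.erase g) (row E) (fun B hB =>
    hA.hall B (hB.trans (Finset.erase_subset _ _)) (by
      rintro rfl
      exact Finset.notMem_erase g B (hB hg)))
  obtain ⟨h1, h2⟩ := isPairMatching_graph hf
  have hmem : ∀ q ∈ (A.erase g).image (fun a => (a, f a)), q.1 ∈ A ∧ q ∈ E := by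
    intro q hq
    obtain ⟨a, ha, rfl⟩ := Finset.mem_image.1 hq
    exact ⟨Finset.mem_of_mem_erase ha, mem_row.1 (hfE a ha)⟩
  obtain ⟨h3, h4⟩ := isPairMatching_outside_union (E := E) (A := A) hME hM h1
    (fun q hq => (hmem q hq).1)
    (fun q hq => .inl (Finset.mem_biUnion.2 ⟨q.1, (hmem q hq).1, mem_row.2 (hmem q hq).2⟩))
  have h5 := card_le_matchNum (Finset.union_subset (outside_subset.trans hME)
    (fun q hq => (hmem q hq).2)) h3
  have h6 := card_le_card_outside (E := E) (A := A) hM (P := (A.biUnion (row E)).erase c)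
    (fun q hq hq' => Finset.mem_erase.2 ⟨hmiss q hq, hq'⟩)
  rw [Finset.card_erase_of_mem hcA] at h6
  rw [Finset.card_erase_of_mem hg] at h2
  have h7 := hA.card
  have h8 : 0 < #(A.biUnion (row E)) := Finset.card_pos.2 ⟨c, hcA⟩
  omega

variable {E' : Finset (α × β)} {v : α} {c c' : β} {q : α × β}

/-- After the move of `(v, c)` to `(v, c')`, the minimal violator can be matched. -/
theorem IsMinViolator.exists_injOn_of_move [Nonempty β] (hA : IsMinViolator E A)
    (hv : v ∈ A) (hvc : (v, c) ∈ E) (h3 : 3 ≤ #(column E A c))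
    (hc' : c' ∉ A.biUnion (row E)) (hkeep : ∀ r ∈ E, r ≠ (v, c) → r ≠ q → r ∈ E')
    (hnew : (v, c') ∈ E') (hq : q.1 ∈ A → q.2 = c ∧ (q.1, c') ∈ E') :
    ∃ g : α → β, Set.InjOn g A ∧
      ∀ a ∈ A, (a, g a) ∈ E' ∧ (g a ∈ A.biUnion (row E) ∨ g a = c') := by
  have hcne : c ≠ c' := by
    rintro rfl
    exact hc' (Finset.mem_biUnion.2 ⟨v, hv, mem_row.2 hvc⟩)
  -- Only `c` can disappear from the neighbourhood of `B`. For `B = A` a third member of the column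
  -- of `c` preserves it and `c'` is gained. For smaller `B`, a lost pair at `c` is paid for by
  -- `c'`.
  have hmain : ∀ B ⊆ A,
      #B ≤ #(B.biUnion fun a => row E' a ∩ insert c' (A.biUnion (row E))) := by
    intro B hB
    have hother : ∀ p ∈ B.biUnion (row E), p ≠ c →
        p ∈ B.biUnion fun a => row E' a ∩ insert c' (A.biUnion (row E)) := by
      intro p hp hpc
      obtain ⟨a, ha, hap⟩ := Finset.mem_biUnion.1 hp
      refine Finset.mem_biUnion.2 ⟨a, ha, Finset.mem_inter.2 ⟨mem_row.2 ?_, ?_⟩⟩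
      · refine hkeep _ (mem_row.1 hap) (fun h => hpc (Prod.ext_iff.1 h).2) ?_
        rintro rfl
        exact hpc (hq (hB ha)).1
      · exact Finset.mem_insert_of_mem (Finset.mem_biUnion.2 ⟨a, hB ha, hap⟩)
    by_cases hBA : B = A
    · subst hBA
      have : insert c' (B.biUnion (row E)) ⊆
          B.biUnion fun a => row E' a ∩ insert c' (B.biUnion (row E)) := by
        intro p hp
        rcases Finset.mem_insert.1 hp with rfl | hp
        · exact Finset.mem_biUnion.2 ⟨v, hv, Finset.mem_inter.2 ⟨mem_row.2 hnew, by simp⟩⟩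
        · by_cases hpc : p = c
          · subst hpc
            obtain ⟨u, hu, hu1⟩ : ∃ u ∈ column E B p, u ∉ ({v, q.1} : Finset α) := by
              refine Finset.exists_mem_notMem_of_card_lt_card ?_
              have := Finset.card_le_two (a := v) (b := q.1)
              omega
            simp only [column, Finset.mem_filter, Finset.mem_insert, Finset.mem_singleton,
              not_or] at hu hu1
            refine Finset.mem_biUnion.2 ⟨u, hu.1, Finset.mem_inter.2 ⟨mem_row.2 ?_, ?_⟩⟩
            · exact hkeep _ hu.2 (fun h => hu1.1 (Prod.ext_iff.1 h).1)
                (fun h => hu1.2 (Prod.ext_iff.1 h).1)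
            · exact Finset.mem_insert_of_mem hp
          · exact hother p hp hpc
      have h1 := Finset.card_le_card this
      rw [Finset.card_insert_of_notMem hc', hA.card] at h1
      exact h1
    · refine (hA.hall B hB hBA).trans ?_
      by_cases hc'B : c' ∈ B.biUnion fun a => row E' a ∩ insert c' (A.biUnion (row E))
      · have : insert c' ((B.biUnion (row E)).erase c) ⊆
            B.biUnion fun a => row E' a ∩ insert c' (A.biUnion (row E)) := by
          intro p hp
          rcases Finset.mem_insert.1 hp with rfl | hp
          · exact hc'B
          · exact hother p (Finset.mem_of_mem_erase hp) (Finset.ne_of_mem_erase hp)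
        have h1 := Finset.card_le_card this
        rw [Finset.card_insert_of_notMem (fun h => hc'
          (Finset.biUnion_subset_biUnion_of_subset_left _ hB (Finset.mem_of_mem_erase h)))] at h1
        have h2 := Finset.pred_card_le_card_erase (s := B.biUnion (row E)) (a := c)
        omega
      · refine Finset.card_le_card fun p hp => ?_
        by_cases hpc : p = c
        · subst hpc
          obtain ⟨a, ha, hap⟩ := Finset.mem_biUnion.1 hp
          refine Finset.mem_biUnion.2 ⟨a, ha, Finset.mem_inter.2 ⟨mem_row.2 ?_, ?_⟩⟩
          · refine hkeep _ (mem_row.1 hap) ?_ ?_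
            · intro h
              obtain rfl : a = v := (Prod.ext_iff.1 h).1
              exact hc'B (Finset.mem_biUnion.2
                ⟨a, ha, Finset.mem_inter.2 ⟨mem_row.2 hnew, by simp⟩⟩)
            · rintro rfl
              exact hc'B (Finset.mem_biUnion.2
                ⟨a, ha, Finset.mem_inter.2 ⟨mem_row.2 (hq (hB ha)).2, by simp⟩⟩)
          · exact Finset.mem_insert_of_mem (Finset.mem_biUnion.2 ⟨a, hB ha, hap⟩)
        · exact hother p hp hpc
  obtain ⟨g, hg, hgt⟩ := exists_injOn_of_hall A _ hmain
  refine ⟨g, hg, fun a ha => ?_⟩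
  have := Finset.mem_inter.1 (hgt a ha)
  exact ⟨mem_row.1 this.1, (Finset.mem_insert.1 this.2).symm⟩

/-- Outside the neighbourhood of `A` keep `M`; inside, replace at most `#A - 1` pairs of `M` by the
`#A` pairs of `g`. The colour `c'` is free because `M` misses it. -/
theorem IsMinViolator.matchNum_lt (hA : IsMinViolator E A) (hME : M ⊆ E)
    (hM : IsPairMatching M) (hcard : #M = matchNum E) (hmiss : ∀ r ∈ M, r.2 ≠ c')
    (hout : outside E A M ⊆ E') {g : α → β} (hg : Set.InjOn g A)
    (hgE : ∀ a ∈ A, (a, g a) ∈ E' ∧ (g a ∈ A.biUnion (row E) ∨ g a = c')) :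
    matchNum E < matchNum E' := by
  obtain ⟨h1, h2⟩ := isPairMatching_graph hg
  obtain ⟨h3, h4⟩ := isPairMatching_outside_union (E := E) (A := A) hME hM h1
    (fun q hq => by obtain ⟨a, ha, rfl⟩ := Finset.mem_image.1 hq; exact ha)
    (fun q hq => by
      obtain ⟨a, ha, rfl⟩ := Finset.mem_image.1 hq
      exact (hgE a ha).2.imp id fun h r hr => by rw [h]; exact hmiss r hr)
  have h5 := card_le_matchNum (E := E') (Finset.union_subset hout (fun q hq => by
    obtain ⟨a, ha, rfl⟩ := Finset.mem_image.1 hq; exact (hgE a ha).1)) h3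
  have h6 := card_le_card_outside (E := E) (A := A) hM (P := A.biUnion (row E))
    (fun q _ hq' => hq')
  have := hA.card
  omega

/-- The neighbours of a minimal violator stay matched into it when two pairs are moved. -/
theorem IsMinViolator.exists_injOn_symm [Nonempty α] (hA : IsMinViolator E A)
    (hrow : ∀ a ∈ A, #(row E a) = 2) (h3 : 3 ≤ #(column E A c))
    (hkeep : ∀ r ∈ E, r ≠ (v, c) → r ≠ q → r ∈ E') :
    ∃ g : β → α, Set.InjOn g (A.biUnion (row E)) ∧
      ∀ p ∈ A.biUnion (row E), g p ∈ A ∧ (g p, p) ∈ E' := by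
  have hmain : ∀ P ⊆ A.biUnion (row E), #P ≤ #(P.biUnion (column E' A)) := by
    intro P hP
    rcases P.eq_empty_or_nonempty with rfl | hne
    · simp
    have h1 := hA.card_lt_touching hP hne
    have hsub : touching E A P \ {v, q.1} ⊆ P.biUnion (column E' A) := by
      intro a ha
      simp only [touching, Finset.mem_sdiff, Finset.mem_filter, Finset.mem_insert,
        Finset.mem_singleton, not_or] at ha
      obtain ⟨⟨haA, p, hp, hap⟩, hav, haq⟩ := ha
      refine Finset.mem_biUnion.2 ⟨p, hp, Finset.mem_filter.2 ⟨haA, hkeep _ hap ?_ ?_⟩⟩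
      · exact fun h => hav (Prod.ext_iff.1 h).1
      · exact fun h => haq (Prod.ext_iff.1 h).1
    by_contra! hlt
    have hsub' : touching E A P ⊆ (P.biUnion (column E' A)) ∪ ({v, q.1} : Finset α) := by
      intro a ha
      by_cases h : a ∈ ({v, q.1} : Finset α)
      · exact Finset.mem_union_right _ h
      · exact Finset.mem_union_left _ (hsub (Finset.mem_sdiff.2 ⟨ha, h⟩))
    have hc2 : #(({v, q.1} : Finset α)) ≤ 2 := Finset.card_le_two
    have hu := Finset.card_union_le (P.biUnion (column E' A)) ({v, q.1} : Finset α)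
    have hu2 := Finset.card_le_card hsub'
    -- Since `P` touches at least `#P + 1` vertices, failure of Hall's condition is tight: `v` and
    -- `q.1` are distinct, touch `P`, and both lose all their pairs into `P`.
    have hpair : #(({v, q.1} : Finset α)) = 2 := by omega
    have hvq : v ≠ q.1 := by
      rintro h
      simp [← h] at hpair
    have hin : ∀ a ∈ ({v, q.1} : Finset α),
        a ∈ touching E A P ∧ a ∉ P.biUnion (column E' A) := by
      intro a ha
      constructor
      · by_contra hna
        have h2 : touching E A P ⊆
            (P.biUnion (column E' A)) ∪ ({v, q.1} : Finset α).erase a := by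
          intro b hb
          rcases Finset.mem_union.1 (hsub' hb) with h | h
          · exact Finset.mem_union_left _ h
          · exact Finset.mem_union_right _ (Finset.mem_erase.2 ⟨fun h' => hna (h' ▸ hb), h⟩)
        have h4 := (Finset.card_le_card h2).trans (Finset.card_union_le _ _)
        rw [Finset.card_erase_of_mem ha] at h4
        omega
      · intro hna
        have h2 : touching E A P ⊆
            (P.biUnion (column E' A)) ∪ ({v, q.1} : Finset α).erase a := by
          intro b hb
          by_cases h' : b = a
          · exact Finset.mem_union_left _ (h' ▸ hna)
          · rcases Finset.mem_union.1 (hsub' hb) with h | h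
            · exact Finset.mem_union_left _ h
            · exact Finset.mem_union_right _ (Finset.mem_erase.2 ⟨h', h⟩)
        have h4 := (Finset.card_le_card h2).trans (Finset.card_union_le _ _)
        rw [Finset.card_erase_of_mem ha] at h4
        omega
    have hlost : ∀ a ∈ ({v, q.1} : Finset α), ∀ p ∈ P, (a, p) ∈ E →
        (a, p) = (v, c) ∨ (a, p) = q := by
      intro a ha p hp hap
      by_contra! hne'
      have haA := (Finset.mem_filter.1 (hin a ha).1).1
      exact (hin a ha).2 (Finset.mem_biUnion.2
        ⟨p, hp, Finset.mem_filter.2 ⟨haA, hkeep _ hap hne'.1 hne'.2⟩⟩)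
    have hcP : c ∈ P := by
      obtain ⟨-, p, hp, hvp⟩ := Finset.mem_filter.1 (hin v (by simp)).1
      rcases hlost v (by simp) p hp hvp with h | h
      · exact (Prod.mk.inj h).2 ▸ hp
      · exact (hvq (Prod.ext_iff.1 h).1).elim
    have hone : ∀ a ∈ ({v, q.1} : Finset α), #(row E a ∩ P) ≤ 1 := by
      intro a ha
      rw [Finset.card_le_one]
      intro x hx y hy
      rw [Finset.mem_inter, mem_row] at hx hy
      rcases hlost a ha x hx.2 hx.1 with h | h <;> rcases hlost a ha y hy.2 hy.1 with h' | h' <;>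
        rw [Prod.ext_iff] at h h'
      · exact h.2.trans h'.2.symm
      · exact (hvq (h.1.symm.trans h'.1)).elim
      · exact (hvq (h'.1.symm.trans h.1)).elim
      · exact h.2.trans h'.2.symm
    -- Count pairs in `A × P` twice: columns have at least two entries and that of `c` three, while
    -- the rows of `v` and `q.1` have at most one and the others at most two.
    have hlow : 2 * #P + 1 ≤ ∑ p ∈ P, #(column E A p) := by
      have h4 : ∑ p ∈ P, (2 + if p = c then 1 else 0) ≤ ∑ p ∈ P, #(column E A p) := by
        refine Finset.sum_le_sum fun p hp => ?_
        have := hA.two_le_card_column (hP hp)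
        split_ifs with h
        · subst h; omega
        · omega
      rw [Finset.sum_add_distrib, Finset.sum_ite_eq' P c, if_pos hcP] at h4
      simp only [Finset.sum_const, smul_eq_mul] at h4
      omega
    have hhigh : ∑ a ∈ A, #(row E a ∩ P) + 2 ≤ 2 * #(touching E A P) := by
      have h4 : ∑ a ∈ touching E A P, #(row E a ∩ P) = ∑ a ∈ A, #(row E a ∩ P) := by
        refine Finset.sum_subset (Finset.filter_subset _ _) fun a ha hna => ?_
        rw [Finset.card_eq_zero, Finset.eq_empty_iff_forall_notMem]
        intro x hx
        rw [Finset.mem_inter, mem_row] at hx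
        exact hna (Finset.mem_filter.2 ⟨ha, x, hx.2, hx.1⟩)
      have h5 : ∑ a ∈ touching E A P,
          (#(row E a ∩ P) + if a ∈ ({v, q.1} : Finset α) then 1 else 0) ≤
          ∑ a ∈ touching E A P, 2 := by
        refine Finset.sum_le_sum fun a ha => ?_
        split_ifs with h
        · have := hone a h; omega
        · have := Finset.card_le_card (Finset.inter_subset_left (s₁ := row E a) (s₂ := P))
          rw [hrow a (Finset.mem_filter.1 ha).1] at this
          omega
      rw [Finset.sum_add_distrib, h4, ← Finset.sum_filter, Finset.filter_mem_eq_inter,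
        Finset.inter_eq_right.2 (fun a ha => (hin a ha).1)] at h5
      simp only [Finset.sum_const, smul_eq_mul, hpair] at h5
      omega
    rw [sum_card_column] at hlow
    omega
  obtain ⟨g, hg, hgt⟩ := exists_injOn_of_hall _ _ hmain
  exact ⟨g, hg, fun p hp => Finset.mem_filter.1 (hgt p hp)⟩

/-- Moving `(v, c)` to `(v, c')`, together with a second pair `q` whose first coordinate lies in
the minimal violator, enlarges the matching number or the set of missed elements. -/
theorem IsMinViolator.card_missed_lt [Nonempty α] [Nonempty β] (hA : IsMinViolator E A)
    {K : Finset β} (hEK : ∀ r ∈ E, r.2 ∈ K) (hrow : ∀ a ∈ A, #(row E a) = 2)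
    (hv : v ∈ A) (hvc : (v, c) ∈ E) (h3 : 3 ≤ #(column E A c)) (hc' : c' ∈ missed K E)
    (hkeep : ∀ r ∈ E, r ≠ (v, c) → r ≠ q → r ∈ E') (hnew : (v, c') ∈ E')
    (hqE : q ∈ E) (hqA : q.1 ∈ A) (hle : matchNum E' ≤ matchNum E) :
    matchNum E ≤ matchNum E' ∧ #(missed K E) < #(missed K E') := by
  have hc'A := hA.notMem_of_mem_missed hc'
  have hqΓ : q.2 ∈ A.biUnion (row E) := Finset.mem_biUnion.2 ⟨q.1, hqA, mem_row.2 hqE⟩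
  have hout : ∀ M ⊆ E, outside E A M ⊆ E' := by
    intro M hME r hr
    have h1 := fst_notMem_of_mem_outside hME hr
    refine hkeep r (hME (outside_subset hr)) ?_ ?_
    · rintro rfl; exact h1 hv
    · rintro rfl; exact h1 hqA
  -- A missed colour stays missed: keep the outside part of its matching and rematch the whole
  -- neighbourhood of `A` into `A` within `E'`.
  have hsub : missed K E ⊆ missed K E' := by
    intro t ht
    have htA := hA.notMem_of_mem_missed ht
    obtain ⟨htK, M, hME, hM, hcard, hmiss⟩ := mem_missed.1 ht
    obtain ⟨g, hg, hgE⟩ := hA.exists_injOn_symm hrow h3 hkeep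
    obtain ⟨h1, h2⟩ := isPairMatching_graph_symm hg
    have hmem : ∀ r ∈ (A.biUnion (row E)).image (fun p => (g p, p)),
        r.1 ∈ A ∧ r ∈ E' ∧ r.2 ∈ A.biUnion (row E) := by
      intro r hr
      obtain ⟨p, hp, rfl⟩ := Finset.mem_image.1 hr
      exact ⟨(hgE p hp).1, (hgE p hp).2, hp⟩
    obtain ⟨h4, h5⟩ := isPairMatching_outside_union (E := E) (A := A) hME hM h1
      (fun r hr => (hmem r hr).1) (fun r hr => .inl (hmem r hr).2.2)
    have h6 := Finset.union_subset (hout M hME) (fun r hr => (hmem r hr).2.1)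
    have h7 := card_le_matchNum h6 h4
    have h8 := card_le_card_outside (E := E) (A := A) hM (P := A.biUnion (row E))
      (fun q _ hq' => hq')
    refine mem_missed.2 ⟨htK, _, h6, h4, by omega, ?_⟩
    intro r hr
    rcases Finset.mem_union.1 hr with hr | hr
    · exact hmiss r (outside_subset hr)
    · exact fun h => htA (h ▸ (hmem r hr).2.2)
  suffices h : matchNum E ≤ matchNum E' ∧ q.2 ∈ missed K E' from
    ⟨h.1, Finset.card_lt_card ⟨hsub, fun hsub' => hA.notMem_of_mem_missed (hsub' h.2) hqΓ⟩⟩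
  obtain ⟨-, M, hME, hM, hcard, hmiss⟩ := mem_missed.1 hc'
  -- Move only `(v, c)` for the moment. The resulting matching of `A` must use `q`, since otherwise
  -- it would survive in `E'` and exceed `matchNum E`. Dropping `q` leaves a matching of size
  -- `matchNum E` in `E'` that misses `q.2`.
  obtain ⟨g, hg, hgE⟩ := hA.exists_injOn_of_move (E' := insert (v, c') (E.erase (v, c)))
    (q := (v, c)) hv hvc h3 hc'A
    (fun r hr h _ => Finset.mem_insert_of_mem (Finset.mem_erase.2 ⟨h, hr⟩))
    (Finset.mem_insert_self _ _) (fun _ => ⟨rfl, Finset.mem_insert_self _ _⟩)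
  have hgE' : ∀ a ∈ A, (a, g a) ≠ q → (a, g a) ∈ E' := by
    intro a ha hne
    rcases Finset.mem_insert.1 (hgE a ha).1 with h | h
    · rw [h]; exact hnew
    · exact hkeep _ (Finset.mem_of_mem_erase h) (Finset.ne_of_mem_erase h) hne
  have hgq : g q.1 = q.2 := by
    by_contra hne
    have := hA.matchNum_lt hME hM hcard hmiss (hout M hME) hg (fun a ha =>
      ⟨hgE' a ha fun h => hne (by
        obtain ⟨h1, h2⟩ := Prod.ext_iff.1 h
        simp only at h1 h2
        rw [← h1, h2]), (hgE a ha).2⟩)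
    omega
  obtain ⟨h1, h2⟩ := isPairMatching_graph (hg.mono (Finset.erase_subset q.1 A))
  have hmem : ∀ r ∈ (A.erase q.1).image (fun a => (a, g a)),
      r.1 ∈ A ∧ r ∈ E' ∧ r.2 ≠ q.2 ∧ (r.2 ∈ A.biUnion (row E) ∨ ∀ s ∈ M, s.2 ≠ r.2) := by
    intro r hr
    obtain ⟨a, ha, rfl⟩ := Finset.mem_image.1 hr
    obtain ⟨hne, ha⟩ := Finset.mem_erase.1 ha
    refine ⟨ha, hgE' a ha fun h => hne (Prod.ext_iff.1 h).1, ?_, ?_⟩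
    · rw [← hgq]
      exact fun h => hne (hg ha hqA h)
    · exact (hgE a ha).2.imp id fun h s hs => by simp only [h]; exact hmiss s hs
  obtain ⟨h4, h5⟩ := isPairMatching_outside_union (E := E) (A := A) hME hM h1
    (fun r hr => (hmem r hr).1) (fun r hr => (hmem r hr).2.2.2)
  have h6 := Finset.union_subset (hout M hME) (fun r hr => (hmem r hr).2.1)
  have h7 := card_le_matchNum h6 h4
  have h8 := card_le_card_outside (E := E) (A := A) hM (P := A.biUnion (row E))
    (fun q _ hq' => hq')
  rw [Finset.card_erase_of_mem hqA] at h2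
  have h9 := hA.card
  refine ⟨by omega, mem_missed.2 ⟨hEK q hqE, _, h6, h4, by omega, ?_⟩⟩
  intro r hr
  rcases Finset.mem_union.1 hr with hr | hr
  · intro h
    simp only [outside, Finset.mem_filter] at hr
    exact hr.2 (h ▸ hqΓ)
  · exact (hmem r hr).2.2.1

end Matching

/-! ### The extremal argument for families closed under Kempe exchanges. -/

section Matching

variable {α β : Type*} [DecidableEq α] [DecidableEq β]

/-- If a family of relations is closed under Kempe exchanges, which move at most two pairs, then
some member of the family contains the graph of an injection. -/
theorem exists_injOn_of_kempe_closed [Nonempty α] [Nonempty β] [Neg β] {N : Finset α}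
    {K : Finset β} (hNK : #N ≤ #K) {𝓔 : Set (Finset (α × β))} (hne : 𝓔.Nonempty)
    (hsub : ∀ E ∈ 𝓔, E ⊆ N ×ˢ K) (hrow : ∀ E ∈ 𝓔, ∀ v ∈ N, #(row E v) = 2)
    (hK : ∀ E ∈ 𝓔, ∀ a ∈ K, ∀ b ∈ K, a ≠ b → ∃ (R : α × β → α × β → Prop) (ι : β → β),
      Equivalence R ∧ ι a = b ∧
      (∀ p ∈ E, ∀ q ∈ E, ∀ r ∈ E, R p q → R p r → q ≠ p → r ≠ p → q = r) ∧
      (∀ p ∈ E, ∀ q ∈ E, p.2 = a → R p q → q ≠ p → q.2 = a ∨ q.2 = b ∨ q.2 = -a ∨ q.2 = -b) ∧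
      ∀ p ∈ E, p.2 = a → ∃ E' ∈ 𝓔, ∀ q ∈ E, (R p q → (q.1, ι q.2) ∈ E') ∧ (¬ R p q → q ∈ E')) :
    ∃ E ∈ 𝓔, ∃ f : α → β, Set.InjOn f N ∧ ∀ v ∈ N, (v, f v) ∈ E := by
  classical
  obtain ⟨E, hE, hEmax⟩ := Finset.exists_max_image {E ∈ (N ×ˢ K).powerset | E ∈ 𝓔}
    (fun E => toLex (matchNum E, #(missed K E))) (by
      obtain ⟨E, hE⟩ := hne
      exact ⟨E, by simp [hE, hsub E hE]⟩)
  replace hE : E ∈ 𝓔 := (Finset.mem_filter.1 hE).2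
  have hmax : ∀ E' ∈ 𝓔, matchNum E' ≤ matchNum E ∧
      (matchNum E' = matchNum E → #(missed K E') ≤ #(missed K E)) := by
    intro E' hE'
    have h := hEmax E' (by simp [hE', hsub E' hE'])
    rw [Prod.Lex.toLex_le_toLex] at h
    rcases h with h | h
    · exact ⟨h.le, fun h' => (h.ne h').elim⟩
    · exact ⟨h.1.le, fun _ => h.2⟩
  have hEN : ∀ q ∈ E, q.1 ∈ N ∧ q.2 ∈ K := fun q hq => Finset.mem_product.1 (hsub E hE hq)
  refine ⟨E, hE, exists_injOn_of_le_matchNum (fun q hq => (hEN q hq).1) ?_⟩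
  by_contra! hlt
  obtain ⟨A, hAN, hA⟩ := exists_isMinViolator hlt
  have hrowA : ∀ a ∈ A, #(row E a) = 2 := fun a ha => hrow E hE a (hAN ha)
  obtain ⟨c, hcA, h3⟩ := hA.exists_three_le_card_column hrowA
  obtain ⟨M, hME, hM, hcard⟩ := exists_card_eq_matchNum E
  obtain ⟨c', hc'K, hc'M⟩ : ∃ c' ∈ K, c' ∉ M.image Prod.snd := by
    refine Finset.exists_mem_notMem_of_card_lt_card ?_
    have := Finset.card_image_le (s := M) (f := Prod.snd)
    omega
  have hmiss : ∀ r ∈ M, r.2 ≠ c' := fun r hr h => hc'M (h ▸ Finset.mem_image_of_mem _ hr)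
  have hc' : c' ∈ missed K E := mem_missed.2 ⟨hc'K, M, hME, hM, hcard, hmiss⟩
  have hc'A := hA.notMem_of_mem_missed hc'
  have hcK : c ∈ K := by
    obtain ⟨a, -, hac⟩ := Finset.mem_biUnion.1 hcA
    exact (hEN _ (mem_row.1 hac)).2
  obtain ⟨R, ι, hR, hι, huniq, hcol, hswap⟩ := hK E hE c hcK c' hc'K (by
    rintro rfl; exact hc'A hcA)
  have hpartner : ∀ v ∈ column E A c, ∃ q ∈ M, R (v, c) q ∧ q ≠ (v, c) ∧
      q.2 ∈ ({-c, -c'} : Finset β) := by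
    intro v hv
    obtain ⟨hvA, hvc⟩ := Finset.mem_filter.1 hv
    obtain ⟨E', hE', hmove⟩ := hswap _ hvc rfl
    have hnew : (v, c') ∈ E' := by
      have := (hmove _ hvc).1 (hR.refl _)
      rwa [hι] at this
    have hgood : ∀ q : α × β, (∀ r ∈ E, r ≠ (v, c) → r ≠ q → r ∈ E') →
        (q.1 ∈ A → q.2 = c ∧ (q.1, c') ∈ E') → q ∉ outside E A M → False := by
      intro q hkeep hq hqM
      obtain ⟨g, hg, hgE⟩ := hA.exists_injOn_of_move hvA hvc h3 hc'A hkeep hnew hq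
      have := hA.matchNum_lt hME hM hcard hmiss (E' := E') (fun r hr => ?_) hg hgE
      · have := (hmax E' hE').1
        omega
      · refine hkeep r (hME (outside_subset hr)) ?_ ?_
        · rintro rfl
          exact fst_notMem_of_mem_outside hME hr hvA
        · rintro rfl
          exact hqM hr
    by_cases hex : ∃ q ∈ E, R (v, c) q ∧ q ≠ (v, c)
    · obtain ⟨q, hqE, hRq, hqv⟩ := hex
      have hkeep : ∀ r ∈ E, r ≠ (v, c) → r ≠ q → r ∈ E' := fun r hr h h' =>
        (hmove r hr).2 fun hRr => h' (huniq _ hvc _ hr _ hqE hRr hRq h hqv)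
      by_cases hqA : q.1 ∈ A
      · exfalso
        by_cases hqc : q.2 = c
        · refine hgood q hkeep (fun _ => ⟨hqc, ?_⟩)
            (fun h => fst_notMem_of_mem_outside hME h hqA)
          have := (hmove q hqE).1 hRq
          rwa [hqc, hι] at this
        · have h1 := hA.card_missed_lt (fun r hr => (hEN r hr).2) hrowA hvA hvc h3 hc' hkeep hnew
            hqE hqA (hmax E' hE').1
          have h2 := hmax E' hE'
          have := h2.2 (le_antisymm h2.1 h1.1)
          omega
      · have hqM : q ∈ outside E A M := by
          by_contra h
          exact hgood q hkeep (fun h => (hqA h).elim) h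
        refine ⟨q, outside_subset hqM, hRq, hqv, ?_⟩
        rcases hcol _ hvc q hqE rfl hRq hqv with h | h | h | h
        · exact ((Finset.mem_filter.1 hqM).2 (h ▸ hcA)).elim
        · exact (hmiss q (outside_subset hqM) h).elim
        · simp [h]
        · simp [h]
    · push Not at hex
      refine (hgood (v, c) (fun r hr h _ => (hmove r hr).2 fun hRr => h (hex r hr hRr))
        (fun _ => ⟨rfl, hnew⟩) fun h => fst_notMem_of_mem_outside hME h hvA).elim
  choose! Q hQM hQR hQne hQc using hpartner
  -- At least three vertices, at most two colours; as `M` has one pair per colour, two vertices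
  -- share a partner.
  obtain ⟨v, hv, w, hw, hvw, hQ⟩ := Finset.exists_ne_map_eq_of_card_lt_of_maps_to
    (s := column E A c) (t := {-c, -c'}) (f := fun v => (Q v).2)
    (lt_of_le_of_lt Finset.card_le_two h3) hQc
  have hQ' : Q v = Q w := hM.2 (hQM v hv) (hQM w hw) hQ
  have hvc := (Finset.mem_filter.1 hv).2
  have hwc := (Finset.mem_filter.1 hw).2
  refine hQne w hw ?_
  rw [← hQ']
  exact huniq _ hvc _ (hME (hQM v hv)) _ hwc (hQR v hv)
    (hR.trans (hQR v hv) (hQ' ▸ hR.symm (hQR w hw))) (hQne v hv)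
    (fun h => hvw (Prod.ext_iff.1 h).1.symm)

end Matching

/-! ### Orbits of two involutions. -/

section Involutions

variable {X : Type*} {f g : Equiv.Perm X}

/-- The dihedral relation: `g` conjugates `f * g` to its inverse. -/
theorem apply_zpow_mul_apply (hf : ∀ x, f (f x) = x) (hg : ∀ x, g (g x) = x) (i : ℤ) (x : X) :
    g (((f * g) ^ i) x) = ((f * g) ^ (-i)) (g x) := by
  have hconj : g * (f * g) * g⁻¹ = (f * g)⁻¹ := by
    ext x
    rw [Equiv.Perm.eq_inv_iff_eq]
    have h : g⁻¹ x = g x := by rw [Equiv.Perm.inv_eq_iff_eq, hg]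
    simp only [Equiv.Perm.mul_apply, h, hg, hf]
  have h : g * (f * g) ^ i * g⁻¹ = (f * g) ^ (-i) := by
    rw [← conj_zpow, hconj, inv_zpow, zpow_neg]
  rw [← h]
  simp

theorem sameCycle_apply_right_of_fixed (hf : ∀ x, f (f x) = x) (hg : ∀ x, g (g x) = x) {x y : X}
    (hx : g x = x) (h : (f * g).SameCycle x y) : (f * g).SameCycle x (g y) := by
  obtain ⟨i, rfl⟩ := h
  exact ⟨-i, by rw [apply_zpow_mul_apply hf hg, hx]⟩

theorem sameCycle_apply_left_of_fixed (hf : ∀ x, f (f x) = x) (hg : ∀ x, g (g x) = x) {x y : X}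
    (hx : g x = x) (h : (f * g).SameCycle x y) : (f * g).SameCycle x (f y) := by
  have h1 := (sameCycle_apply_right_of_fixed hf hg hx h).trans
    (Equiv.Perm.sameCycle_apply_right.2 (Equiv.Perm.SameCycle.refl (f * g) (g y)))
  simpa [hg] using h1

/-- A cycle of the product of two involutions contains at most two fixed points of the second. -/
theorem eq_of_sameCycle_of_fixed (hf : ∀ x, f (f x) = x) (hg : ∀ x, g (g x) = x) {x y z : X}
    (hx : g x = x) (hy : g y = y) (hz : g z = z) (hxy : (f * g).SameCycle x y)
    (hxz : (f * g).SameCycle x z) (hyx : y ≠ x) (hzx : z ≠ x) : y = z := by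
  obtain ⟨i, rfl⟩ := hxy
  obtain ⟨j, rfl⟩ := hxz
  let L : ℤ := ((Function.minimalPeriod ((f * g) • ·) x : ℕ) : ℤ)
  have key : ∀ n : ℤ, ((f * g) ^ n) x = x ↔ L ∣ n := fun n =>
    MulAction.zpow_smul_eq_iff_minimalPeriod_dvd (a := f * g) (b := x)
  have htwo : ∀ n : ℤ, g (((f * g) ^ n) x) = ((f * g) ^ n) x → L ∣ 2 * n := by
    intro n h
    rw [apply_zpow_mul_apply hf hg, hx, zpow_neg, Equiv.Perm.inv_eq_iff_eq] at h
    rw [← key, two_mul, zpow_add, Equiv.Perm.mul_apply]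
    exact h.symm
  obtain ⟨m, hm⟩ := htwo i hy
  obtain ⟨m', hm'⟩ := htwo j hz
  have hi : ¬ L ∣ i := fun h => hyx ((key i).2 h)
  have hj : ¬ L ∣ j := fun h => hzx ((key j).2 h)
  -- Fixed points other than `x` have exponents that are odd multiples of half the period, so two of
  -- them differ by a multiple of the period. The case `L = 0` is an infinite orbit.
  have hodd : ∀ n l : ℤ, 2 * n = L * l → ¬ L ∣ n → Odd l := by
    intro n l h hn
    by_contra hl
    obtain ⟨r, rfl⟩ := Int.not_odd_iff_even.1 hl
    exact hn ⟨r, by linarith⟩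
  obtain ⟨r, hr⟩ := (hodd i m hm hi).sub_odd (hodd j m' hm' hj)
  have hdvd : L ∣ i - j := ⟨r, by
    have : 2 * (i - j) = L * (m - m') := by rw [mul_sub, mul_sub, hm, hm']
    rw [hr] at this
    linarith⟩
  have h1 := (key (i - j)).2 hdvd
  rw [sub_eq_neg_add, zpow_add, Equiv.Perm.mul_apply, zpow_neg, Equiv.Perm.inv_eq_iff_eq] at h1
  exact h1

end Involutions

/-! ### The signed colour exchange. -/

section PairSwap

/-- The odd involution of `ℤ` that exchanges `a` with `b`, and `-a` with `-b`. -/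
def pairSwap (a b x : ℤ) : ℤ :=
  if x = a then b else if x = b then a else if x = -a then -b else if x = -b then -a else x

variable {a b : ℤ}

theorem pairSwap_left : pairSwap a b a = b := by simp [pairSwap]

theorem pairSwap_pairSwap (ha : a ≠ 0) (hb : b ≠ 0) (x : ℤ) :
    pairSwap a b (pairSwap a b x) = x := by
  unfold pairSwap
  grind

theorem pairSwap_neg (ha : a ≠ 0) (hb : b ≠ 0) (x : ℤ) :
    pairSwap a b (-x) = -pairSwap a b x := by
  unfold pairSwap
  grind

theorem pairSwap_mul (ha : a ≠ 0) (hb : b ≠ 0) {s : ℤ} (hs : s = 1 ∨ s = -1) (x : ℤ) :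
    pairSwap a b (s * x) = s * pairSwap a b x := by
  rcases hs with rfl | rfl
  · simp
  · simp [pairSwap_neg ha hb]

theorem pairSwap_of_ne {x : ℤ} (h : ¬ (x = a ∨ x = b ∨ x = -a ∨ x = -b)) :
    pairSwap a b x = x := by
  unfold pairSwap
  grind

theorem pairSwap_mem {K : Finset ℤ} (hK : ∀ x ∈ K, -x ∈ K) (ha : a ∈ K) (hb : b ∈ K) {x : ℤ}
    (hx : x ∈ K) : pairSwap a b x ∈ K := by
  unfold pairSwap
  split_ifs <;> simp_all

end PairSwap

/-! ### Kempe components of signed colourings. -/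

section Kempe

variable {V : Type*}

/-- `γ v w` is the colour, in `K`, of the incidence of `v` with the edge `vw`; these colours form a
proper colouring of the graph `H` with the signs `s`. -/
structure IsDartColoring (H : SimpleGraph V) (s : V → V → ℤ) (K : Finset ℤ) (γ : V → V → ℤ) :
    Prop where
  mem : ∀ v w, H.Adj v w → γ v w ∈ K
  edge : ∀ v w, H.Adj v w → γ v w = -s v w * γ w v
  proper : ∀ v w w', H.Adj v w → H.Adj v w' → γ v w = γ v w' → w = w'

open Classical in
/-- The other end of the edge at `p.1` with the colour `p.2`, with its colour there. -/
noncomputable def across (H : SimpleGraph V) (γ : V → V → ℤ) (p : V × ℤ) : V × ℤ :=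
  if h : ∃ w, H.Adj p.1 w ∧ γ p.1 w = p.2 then (h.choose, γ h.choose p.1) else p

variable {H : SimpleGraph V} {s : V → V → ℤ} {K : Finset ℤ} {γ : V → V → ℤ}

theorem IsDartColoring.across_eq (hγ : IsDartColoring H s K γ) {v w : V} (h : H.Adj v w) :
    across H γ (v, γ v w) = (w, γ w v) := by
  have hex : ∃ u, H.Adj v u ∧ γ v u = γ v w := ⟨w, h, rfl⟩
  have hw : hex.choose = w := hγ.proper _ _ _ hex.choose_spec.1 h hex.choose_spec.2
  simp only [across]
  rw [dif_pos hex, hw]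

theorem across_of_missing {p : V × ℤ} (h : ∀ w, H.Adj p.1 w → γ p.1 w ≠ p.2) :
    across H γ p = p := by
  rw [across, dif_neg]
  rintro ⟨w, hw, hw'⟩
  exact h w hw hw'

theorem IsDartColoring.across_across (hγ : IsDartColoring H s K γ) (p : V × ℤ) :
    across H γ (across H γ p) = p := by
  by_cases h : ∃ w, H.Adj p.1 w ∧ γ p.1 w = p.2
  · obtain ⟨w, hw, hw'⟩ := h
    have hp : p = (p.1, γ p.1 w) := Prod.ext rfl hw'.symm
    rw [hp, hγ.across_eq hw, hγ.across_eq hw.symm]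
  · push Not at h
    rw [across_of_missing h, across_of_missing h]

variable {C : Set (V × ℤ)} {ι : ℤ → ℤ}

open Classical in
/-- Exchanging colours along the incidences in `C` gives a colouring. -/
theorem IsDartColoring.exchange (hγ : IsDartColoring H s K γ) (hs : ∀ v w, s v w = 1 ∨ s v w = -1)
    (hι : ∀ x, ι (ι x) = x) (hιs : ∀ t : ℤ, t = 1 ∨ t = -1 → ∀ x, ι (t * x) = t * ι x)
    (hιK : ∀ x ∈ K, ι x ∈ K) (hC : ∀ v x, (v, x) ∈ C → (v, ι x) ∈ C)
    (hC' : ∀ v w, H.Adj v w → (v, γ v w) ∈ C → (w, γ w v) ∈ C) :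
    IsDartColoring H s K (fun v w => if (v, γ v w) ∈ C then ι (γ v w) else γ v w) where
  mem v w h := by
    split_ifs
    · exact hιK _ (hγ.mem v w h)
    · exact hγ.mem v w h
  edge v w h := by
    have hiff : (v, γ v w) ∈ C ↔ (w, γ w v) ∈ C := ⟨hC' v w h, hC' w v h.symm⟩
    have h1 := hγ.edge v w h
    by_cases hc : (w, γ w v) ∈ C
    · simp only [hiff, hc, if_true]
      rw [h1, hιs]
      rcases hs v w with h | h <;> simp [h]
    · simp only [hiff, hc, if_false]
      exact h1
  proper v w w' h h' heq := by
    apply hγ.proper v w w' h h'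
    split_ifs at heq with h1 h2 h2
    · rw [← hι (γ v w), heq, hι]
    · exact (h2 (heq ▸ hC _ _ h1)).elim
    · exact (h1 (heq ▸ hC _ _ h2)).elim
    · exact heq

open Classical in
theorem exchange_missing (hι : ∀ x, ι (ι x) = x) (hC : ∀ v x, (v, x) ∈ C → (v, ι x) ∈ C)
    {v : V} {x : ℤ} (hx : ∀ w, H.Adj v w → γ v w ≠ x) (w : V) (hw : H.Adj v w) :
    (if (v, γ v w) ∈ C then ι (γ v w) else γ v w) ≠ if (v, x) ∈ C then ι x else x := by
  intro h
  apply hx w hw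
  split_ifs at h with h1 h2 h2
  · rw [← hι (γ v w), h, hι]
  · exact (h2 (h ▸ hC _ _ h1)).elim
  · refine (h1 (h ▸ hC _ _ h2)).elim
  · exact h

/-- The possible choices of two missing colours at each vertex of `N`, over all colourings; the
colours at `v` are multiplied by `η v`. -/
def missingFamily (H : SimpleGraph V) (s : V → V → ℤ) (K : Finset ℤ) (N : Finset V)
    (η : V → ℤ) [DecidableEq V] : Set (Finset (V × ℤ)) :=
  {E | E ⊆ N ×ˢ K ∧ (∀ v ∈ N, #(row E v) = 2) ∧ ∃ γ, IsDartColoring H s K γ ∧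
    ∀ q ∈ E, ∀ w, H.Adj q.1 w → γ q.1 w ≠ η q.1 * q.2}

/-- The components are the cycles of `f * g`, where `f` exchanges colours at a vertex and `g`
crosses an edge. Missing colours are fixed points of `g`, so they are the ends of components. -/
theorem missingFamily_kempe [DecidableEq V] (hs : ∀ v w, s v w = 1 ∨ s v w = -1)
    (hK : ∀ x ∈ K, -x ∈ K) (hK0 : (0 : ℤ) ∉ K) {N : Finset V} {η : V → ℤ}
    (hη : ∀ v, η v = 1 ∨ η v = -1) {E : Finset (V × ℤ)} (hE : E ∈ missingFamily H s K N η)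
    {a b : ℤ} (ha : a ∈ K) (hb : b ∈ K) :
    ∃ (R : V × ℤ → V × ℤ → Prop) (ι : ℤ → ℤ), Equivalence R ∧ ι a = b ∧
      (∀ p ∈ E, ∀ q ∈ E, ∀ r ∈ E, R p q → R p r → q ≠ p → r ≠ p → q = r) ∧
      (∀ p ∈ E, ∀ q ∈ E, p.2 = a → R p q → q ≠ p → q.2 = a ∨ q.2 = b ∨ q.2 = -a ∨ q.2 = -b) ∧
      ∀ p ∈ E, p.2 = a → ∃ E' ∈ missingFamily H s K N η,
        ∀ q ∈ E, (R p q → (q.1, ι q.2) ∈ E') ∧ (¬ R p q → q ∈ E') := by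
  classical
  obtain ⟨hEsub, hrow, γ, hγ, hmiss⟩ := hE
  have ha0 : a ≠ 0 := fun h => hK0 (h ▸ ha)
  have hb0 : b ≠ 0 := fun h => hK0 (h ▸ hb)
  have hι := pairSwap_pairSwap ha0 hb0
  have hF : Function.Involutive fun p : V × ℤ => (p.1, pairSwap a b p.2) := fun p => by
    simp [hι]
  set f : Equiv.Perm (V × ℤ) := hF.toPerm with hf
  have hfa : ∀ p, f p = (p.1, pairSwap a b p.2) := fun p => rfl
  have hff : ∀ p, f (f p) = p := fun p => hF p
  set g : Equiv.Perm (V × ℤ) :=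
    Function.Involutive.toPerm (across H γ) (hγ.across_across) with hg
  have hga : ∀ p, g p = across H γ p := fun p => rfl
  have hgg : ∀ p, g (g p) = p := fun p => hγ.across_across p
  -- Converts a normalised colour to the actual one at the vertex; `pairSwap` is odd, so it commutes
  -- with this change of sign.
  let φ : V × ℤ → V × ℤ := fun p => (p.1, η p.1 * p.2)
  have hφ : Function.Injective φ := by
    rintro ⟨v, x⟩ ⟨w, y⟩ h
    obtain ⟨h1, h2⟩ := Prod.mk.inj h
    simp only at h1 h2
    subst h1
    rcases hη v with h | h <;> simp_all
  have hfix : ∀ q ∈ E, g (φ q) = φ q := fun q hq => across_of_missing (hmiss q hq)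
  refine ⟨fun p q => (f * g).SameCycle (φ p) (φ q), pairSwap a b,
    ⟨fun p => .refl _ _, fun h => h.symm, fun h h' => h.trans h'⟩, pairSwap_left, ?_, ?_, ?_⟩
  · intro p hp q hq r hr hpq hpr hqp hrp
    exact hφ (eq_of_sameCycle_of_fixed hff hgg (hfix p hp) (hfix q hq) (hfix r hr) hpq hpr
      (fun h => hqp (hφ h)) (fun h => hrp (hφ h)))
  · intro p hp q hq _ hpq hqp
    by_contra hne
    refine hqp (hφ (hpq.eq_of_right ?_)).symm
    -- A missing colour outside `±a, ±b` is fixed by both involutions, hence is alone in its cycle.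
    change f (g (φ q)) = φ q
    rw [hfix q hq, hfa]
    simp only [φ]
    rw [pairSwap_mul ha0 hb0 (hη _), pairSwap_of_ne hne]
  · intro p hp _
    set C : Set (V × ℤ) := {q | (f * g).SameCycle (φ p) q} with hCdef
    have hC : ∀ v x, (v, x) ∈ C → (v, pairSwap a b x) ∈ C := fun v x h =>
      sameCycle_apply_left_of_fixed hff hgg (hfix p hp) h
    have hC' : ∀ v w, H.Adj v w → (v, γ v w) ∈ C → (w, γ w v) ∈ C := fun v w hvw h => by
      have := sameCycle_apply_right_of_fixed hff hgg (hfix p hp) h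
      rwa [hga, hγ.across_eq hvw] at this
    set m : V × ℤ → V × ℤ := fun q => if φ q ∈ C then (q.1, pairSwap a b q.2) else q with hm
    have hm1 : ∀ q, (m q).1 = q.1 := fun q => by simp only [hm]; split_ifs <;> rfl
    have hm2 : ∀ q, η q.1 * (m q).2 =
        if (q.1, η q.1 * q.2) ∈ C then pairSwap a b (η q.1 * q.2) else η q.1 * q.2 := by
      intro q
      simp only [hm, φ]
      split_ifs
      · rw [pairSwap_mul ha0 hb0 (hη _)]
      · rfl
    have hφswap : ∀ q, φ q ∈ C → φ (q.1, pairSwap a b q.2) ∈ C := fun q h => by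
      have := hC _ _ h
      rwa [pairSwap_mul ha0 hb0 (hη _)] at this
    have hminj : Function.Injective m := by
      intro q r h
      simp only [hm] at h
      split_ifs at h with h1 h2 h2
      · obtain ⟨h3, h4⟩ := Prod.mk.inj h
        refine Prod.ext h3 ?_
        rw [← hι q.2, h4, hι]
      · exact (h2 (h ▸ hφswap q h1)).elim
      · exact (h1 (h ▸ hφswap r h2)).elim
      · exact h
    refine ⟨E.image m, ⟨?_, ?_, _, hγ.exchange hs hι
      (fun t ht x => pairSwap_mul ha0 hb0 ht x) (fun x hx => pairSwap_mem hK ha hb hx) hC hC', ?_⟩,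
      ?_⟩
    · intro r hr
      obtain ⟨q, hq, rfl⟩ := Finset.mem_image.1 hr
      have h1 := Finset.mem_product.1 (hEsub hq)
      refine Finset.mem_product.2 ⟨by rw [hm1]; exact h1.1, ?_⟩
      simp only [hm]
      split_ifs
      · exact pairSwap_mem hK ha hb h1.2
      · exact h1.2
    · intro v hv
      rw [← hrow v hv]
      refine (Finset.card_bij (fun x _ => (m (v, x)).2) ?_ ?_ ?_).symm
      · intro x hx
        rw [mem_row] at hx ⊢
        exact Finset.mem_image.2 ⟨_, hx, Prod.ext (hm1 _) rfl⟩
      · intro x _ y _ hxy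
        exact (Prod.mk.inj (hminj (Prod.ext ((hm1 (v, x)).trans (hm1 (v, y)).symm) hxy))).2
      · intro y hy
        rw [mem_row] at hy
        obtain ⟨q, hq, hqy⟩ := Finset.mem_image.1 hy
        have h1 : q.1 = v := by rw [← hm1 q, hqy]
        refine ⟨q.2, mem_row.2 (h1 ▸ hq), ?_⟩
        rw [← h1, show (q.1, q.2) = q from rfl, hqy]
    · intro r hr
      obtain ⟨q, hq, rfl⟩ := Finset.mem_image.1 hr
      rw [hm1, hm2]
      exact exchange_missing hι hC (hmiss q hq)
    · intro q hq
      constructor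
      · intro h
        exact Finset.mem_image.2 ⟨q, hq, if_pos h⟩
      · intro h
        exact Finset.mem_image.2 ⟨q, hq, if_neg h⟩

end Kempe

/-! ### Restoring the edges at a vertex, and the induction. -/

section Main

/-- The nonzero integers of absolute value at most `k`. -/
noncomputable def nonzeroColors (k : ℕ) : Finset ℤ := (Finset.Icc (-(k : ℤ)) k).erase 0

theorem mem_nonzeroColors {k : ℕ} {x : ℤ} : x ∈ nonzeroColors k ↔ x ≠ 0 ∧ |x| ≤ k := by
  simp [nonzeroColors, abs_le]

theorem card_nonzeroColors (k : ℕ) : #(nonzeroColors k) = 2 * k := by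
  rw [nonzeroColors, Finset.card_erase_of_mem (by simp), Int.card_Icc]
  omega

variable {V : Type*} [Fintype V] [DecidableEq V] {s : V → V → ℤ} {k : ℕ}

open Classical in
/-- A colouring of the graph without the edges at `u` gives one of the whole graph, if all
neighbours of `u` have degree less than the number of colours. -/
theorem exists_isDartColoring_of_delete_edges (hs : ∀ v w, s v w = 1 ∨ s v w = -1)
    (hsymm : ∀ v w, s v w = s w v) {H H' : SimpleGraph V} {u : V}
    (hadj : ∀ {v w}, H'.Adj v w ↔ H.Adj v w ∧ v ≠ u ∧ w ≠ u) (hu : H.degree u ≤ 2 * k)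
    (hnb : ∀ v, H.Adj u v → H.degree v + 1 ≤ 2 * k)
    (hcol : ∃ γ, IsDartColoring H' s (nonzeroColors k) γ) :
    ∃ γ, IsDartColoring H s (nonzeroColors k) γ := by
  obtain ⟨γ, hγ⟩ := hcol
  set K := nonzeroColors k with hKdef
  let η : V → ℤ := fun v => -s u v
  have hη : ∀ v, η v = 1 ∨ η v = -1 := fun v => by rcases hs u v with h | h <;> simp [η, h]
  have hηη : ∀ v x, η v * (η v * x) = x := fun v x => by rcases hη v with h | h <;> simp [h]
  have hmissing : ∀ v ∈ H.neighborFinset u, ∃ S ⊆ K, #S = 2 ∧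
      ∀ c ∈ S, ∀ w, H'.Adj v w → γ v w ≠ η v * c := by
    intro v hv
    rw [SimpleGraph.mem_neighborFinset] at hv
    -- The degree of `v` is below `2 * k` and drops by at least one when the edge to `u` is removed.
    have h1 : 2 ≤ #(K \ (H'.neighborFinset v).image fun w => η v * γ v w) := by
      have h2 := Finset.le_card_sdiff ((H'.neighborFinset v).image fun w => η v * γ v w) K
      have h3 := Finset.card_image_le (s := H'.neighborFinset v) (f := fun w => η v * γ v w)
      have h4 : #(H'.neighborFinset v) < #(H.neighborFinset v) := by
        refine Finset.card_lt_card ⟨fun w hw => ?_, fun h => ?_⟩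
        · rw [SimpleGraph.mem_neighborFinset] at hw ⊢
          exact (hadj.1 hw).1
        · have := h ((SimpleGraph.mem_neighborFinset _ _ _).2 hv.symm)
          rw [SimpleGraph.mem_neighborFinset] at this
          exact (hadj.1 this).2.2 rfl
      rw [SimpleGraph.card_neighborFinset_eq_degree H] at h4
      have h5 := hnb v hv
      rw [hKdef, card_nonzeroColors] at h2
      rw [hKdef]
      omega
    obtain ⟨S, hS, hScard⟩ := Finset.exists_subset_card_eq h1
    refine ⟨S, hS.trans Finset.sdiff_subset, hScard, fun c hc w hw h => ?_⟩
    refine (Finset.mem_sdiff.1 (hS hc)).2 (Finset.mem_image.2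
      ⟨w, (SimpleGraph.mem_neighborFinset _ _ _).2 hw, ?_⟩)
    rw [h, hηη]
  choose! S hSK hS2 hSm using hmissing
  have hmemE : ∀ v c, (v, c) ∈ (H.neighborFinset u).biUnion (fun v => (S v).image (Prod.mk v)) ↔
      v ∈ H.neighborFinset u ∧ c ∈ S v := by
    intro v c
    simp only [Finset.mem_biUnion, Finset.mem_image, Prod.mk.injEq]
    constructor
    · rintro ⟨w, hw, d, hd, rfl, rfl⟩
      exact ⟨hw, hd⟩
    · rintro ⟨hv, hc⟩
      exact ⟨v, hv, c, hc, rfl, rfl⟩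
  have : Nonempty V := ⟨u⟩
  obtain ⟨E, ⟨hEsub, -, γ', hγ', hmiss⟩, f, hf, hfE⟩ := exists_injOn_of_kempe_closed
    (N := H.neighborFinset u) (K := K) (𝓔 := missingFamily H' s K (H.neighborFinset u) η)
    (by rw [SimpleGraph.card_neighborFinset_eq_degree, hKdef, card_nonzeroColors]; exact hu)
    ⟨(H.neighborFinset u).biUnion (fun v => (S v).image (Prod.mk v)), by
      intro ⟨v, c⟩ hq
      rw [hmemE] at hq
      exact Finset.mem_product.2 ⟨hq.1, hSK v hq.1 hq.2⟩, by
      intro v hv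
      rw [← hS2 v hv]
      congr 1
      ext c
      rw [mem_row, hmemE]
      exact and_iff_right hv, γ, hγ, by
      rintro ⟨v, c⟩ hq
      rw [hmemE] at hq
      exact hSm v hq.1 c hq.2⟩
    (fun E hE => hE.1) (fun E hE => hE.2.1)
    (fun E hE a ha b hb _ => missingFamily_kempe hs
      (fun x hx => by
        rw [hKdef, mem_nonzeroColors] at hx ⊢
        simpa using hx)
      (by simp [hKdef, mem_nonzeroColors]) hη hE ha hb)
  have hfK : ∀ v, H.Adj u v → f v ∈ K := fun v hv =>
    (Finset.mem_product.1 (hEsub (hfE v ((SimpleGraph.mem_neighborFinset _ _ _).2 hv)))).2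
  have hfm : ∀ v, H.Adj u v → ∀ w, H'.Adj v w → γ' v w ≠ η v * f v := fun v hv =>
    hmiss _ (hfE v ((SimpleGraph.mem_neighborFinset _ _ _).2 hv))
  refine ⟨fun v w => if v = u then f w else if w = u then η v * f v else γ' v w, ?_, ?_, ?_⟩
  · intro v w h
    split_ifs with h1 h2
    · exact hfK w (h1 ▸ h)
    · have := hfK v (h2 ▸ h.symm)
      rw [hKdef, mem_nonzeroColors] at this ⊢
      rcases hη v with h | h <;> simpa [h] using this
    · exact hγ'.mem v w (hadj.2 ⟨h, h1, h2⟩)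
  · intro v w h
    split_ifs with h1 h2 h2
    · exact (h.ne (h1.trans h2.symm)).elim
    · rw [h1]
      exact (hηη w (f w)).symm
    · rw [h2, hsymm v u]
    · exact hγ'.edge v w (hadj.2 ⟨h, h1, h2⟩)
  · intro v w w' h h' heq
    split_ifs at heq with h1 h2 h3 h3
    · subst h1
      exact hf (by simpa using h) (by simpa using h') heq
    · exact h2.trans h3.symm
    · subst h2
      exact (hfm v h.symm w' (hadj.2 ⟨h', h1, h3⟩) heq.symm).elim
    · subst h3
      exact (hfm v h'.symm w (hadj.2 ⟨h, h1, h2⟩) heq).elim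
    · exact hγ'.proper v w w' (hadj.2 ⟨h, h1, h2⟩) (hadj.2 ⟨h', h1, h3⟩) heq

open Classical in
/-- A signed graph with degrees at most `2 * k`, in which no two vertices of degree `2 * k` are
adjacent, has a colouring with the `2 * k` nonzero colours. -/
theorem exists_isDartColoring (hs : ∀ v w, s v w = 1 ∨ s v w = -1)
    (hsymm : ∀ v w, s v w = s w v) (H : SimpleGraph V) (hdeg : ∀ v, H.degree v ≤ 2 * k)
    (hind : ∀ v w, H.Adj v w → H.degree v = 2 * k → H.degree w ≠ 2 * k) :
    ∃ γ, IsDartColoring H s (nonzeroColors k) γ := by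
  induction hm : #H.edgeFinset using Nat.strong_induction_on generalizing H with
  | _ m ih =>
    by_cases hbot : ∃ v w, H.Adj v w
    · obtain ⟨u, ⟨x, hux⟩, hnb⟩ : ∃ u, (∃ x, H.Adj u x) ∧
          ∀ v, H.Adj u v → H.degree v + 1 ≤ 2 * k := by
        -- A vertex of degree `2 * k` has no neighbour of that degree; if no such non-isolated
        -- vertex exists, any vertex with an edge serves.
        by_cases hmax : ∃ u, (∃ x, H.Adj u x) ∧ H.degree u = 2 * k
        · obtain ⟨u, hu, hu'⟩ := hmax
          exact ⟨u, hu, fun v hv => lt_of_le_of_ne (hdeg v) (hind u v hv hu')⟩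
        · obtain ⟨u, x, hux⟩ := hbot
          exact ⟨u, ⟨x, hux⟩, fun v hv => lt_of_le_of_ne (hdeg v) fun h =>
            hmax ⟨v, ⟨u, hv.symm⟩, h⟩⟩
      obtain ⟨H', hadj⟩ : ∃ H' : SimpleGraph V, ∀ {v w}, H'.Adj v w ↔
          H.Adj v w ∧ v ≠ u ∧ w ≠ u := ⟨H.deleteIncidenceSet u, H.deleteIncidenceSet_adj⟩
      have hle : H' ≤ H := fun v w h => (hadj.1 h).1
      have hdle : ∀ v, H'.degree v ≤ H.degree v := fun v => SimpleGraph.degree_le_of_le hle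
      refine exists_isDartColoring_of_delete_edges hs hsymm hadj (hdeg u) hnb
        (ih _ ?_ _ (fun v => (hdle v).trans (hdeg v)) (fun v w h hv hw => ?_) rfl)
      · rw [← hm]
        refine Finset.card_lt_card (SimpleGraph.edgeFinset_ssubset_edgeFinset.2
          (lt_of_le_of_ne hle fun h => ?_))
        rw [← h] at hux
        exact (hadj.1 hux).2.1 rfl
      · exact hind v w (hle h) (le_antisymm (hdeg v) (hv ▸ hdle v))
          (le_antisymm (hdeg w) (hw ▸ hdle w))
    · push Not at hbot
      exact ⟨fun _ _ => 0, fun v w h => (hbot v w h).elim, fun v w h => (hbot v w h).elim,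
        fun v w _ h => (hbot v w h).elim⟩

end Main

end SignedGraph

end

/-! ### From colours of ordered adjacent pairs to colours of incidences. -/

theorem mainTheorem3 {V : Type*} [Fintype V] (S : SignedGraph V) [DecidableRel S.graph.Adj]
    (hEven : Even S.graph.maxDegree)
    (hIndep : S.graph.IsIndepSet S.maxDegreeVertices) :
    ∃ γ : S.Incidence → ℤ,
      S.IsEdgeColoring S.graph.maxDegree γ ∧ S.IsProper γ ∧ S.IsZeroFree γ := by
  classical
  obtain ⟨k, hk⟩ := hEven
  rw [← two_mul] at hk
  let s : V → V → ℤ := fun v w =>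
    if h : s(v, w) ∈ S.graph.edgeSet then (S.sign ⟨s(v, w), h⟩ : ℤ) else 1
  have hs : ∀ v w, s v w = 1 ∨ s v w = -1 := by
    intro v w
    simp only [s]
    split_ifs with h
    · rcases Int.units_eq_one_or (S.sign ⟨s(v, w), h⟩) with h' | h' <;> simp [h']
    · exact .inl rfl
  have hsymm : ∀ v w, s v w = s w v := by
    intro v w
    simp only [s, Sym2.eq_swap (a := v) (b := w)]
  obtain ⟨γ, hγ⟩ := SignedGraph.exists_isDartColoring (k := k) hs hsymm S.graph
    (fun v => by rw [← hk]; convert S.graph.degree_le_maxDegree v)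
    (fun v w h hv hw => hIndep
      (show S.graph.degree v = S.graph.maxDegree by rw [hk, ← hv]; congr!)
      (show S.graph.degree w = S.graph.maxDegree by rw [hk, ← hw]; congr!) h.ne h)
  have hother : ∀ i : S.Incidence, S.graph.Adj i.vertex (Sym2.Mem.other i.mem) := by
    intro i
    have := i.edge.2
    rw [← Sym2.other_spec i.mem] at this
    exact this
  refine ⟨fun i => γ i.vertex (Sym2.Mem.other i.mem), ⟨fun i => ?_, fun i j he hv => ?_⟩,
    fun i j hv he h => ?_, fun i => ?_⟩
  · have := SignedGraph.mem_nonzeroColors.1 (hγ.mem _ _ (hother i))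
    refine ⟨?_, fun _ => this.1⟩
    rw [hk, Nat.mul_div_cancel_left _ two_pos]
    exact this.2
  · have h1 : (i.edge : Sym2 V) = s(i.vertex, j.vertex) :=
      ((Sym2.mem_and_mem_iff hv).1 ⟨i.mem, he ▸ j.mem⟩)
    have h2 : Sym2.Mem.other i.mem = j.vertex :=
      Sym2.congr_right.1 ((Sym2.other_spec i.mem).trans h1)
    have h3 : Sym2.Mem.other j.mem = i.vertex :=
      Sym2.congr_right.1 (((Sym2.other_spec j.mem).trans (he ▸ h1)).trans Sym2.eq_swap)
    have h4 : s i.vertex j.vertex = S.sign i.edge := by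
      have hmem : s(i.vertex, j.vertex) ∈ S.graph.edgeSet := h1 ▸ i.edge.2
      simp only [s]
      rw [dif_pos hmem]
      congr 2
      exact Subtype.ext h1.symm
    have h5 := hγ.edge _ _ (hother i)
    rw [h2, h4] at h5
    simp only [h2, h3]
    exact h5
  · apply he
    have h1 := hother j
    have h2 : Sym2.Mem.other i.mem = Sym2.Mem.other j.mem := by
      simp only at h
      refine hγ.proper i.vertex _ _ (hother i) (by rw [hv]; exact h1) ?_
      rw [h, hv]
    refine Subtype.ext ?_
    rw [← Sym2.other_spec i.mem, ← Sym2.other_spec j.mem, h2, hv]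
  · exact (SignedGraph.mem_nonzeroColors.1 (hγ.mem _ _ (hother i))).1
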